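/- Let $\alpha\in(0,1)$, $p\in[1,2]$, $a_-,a_+,\lambda_-,\lambda_+>0$, and let $\ell^p(\mathbb N)$ be the Banach space of complex $p$-summable sequences $(z_n)_{n\ge 0}$, with canonical basis $(e_n)_{n\ge0}$. Let $(\omega_n)_{n\ge 0}$ be a bounded sequence of positive numbers, let $k_0>0$, put $k_n:=k_0\prod_{l=0}^{n-1}\omega_l^{-1}$ for $n\ge 1$, and assume that $\sum_{n\ge0}k_n^\alpha<\infty$. Let $\theta_{1,n},\theta_{2,n}$, $n\ge0$, be independent real random variables, all having the tempered stable law with characteristic function $$t\mapsto\exp\Big(\int_{\mathbb R}\big(e^{itx}-1-i\kappa(x)tx\big)\lambda(dx)\Big),\qquad \kappa(x)=\mathbf 1_{\{|x|<1\}}+\tfrac1{|x|}\mathbf 1_{\{|x|\ge1\}},$$ $$\lambda(dx)=a_-\frac{e^{-\lambda_-|x|}}{|x|^{1+\alpha}}\mathbf 1_{\{x<0\}}\,dx+a_+\frac{e^{-\lambda_+x}}{x^{1+\alpha}}\mathbf 1_{\{x>0\}}\,dx .$$ Then the random series $\sum_{n\ge0}k_n(\theta_{1,n}+i\theta_{2,n})e_n$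 converges almost surely in $\ell^p(\mathbb N)$ and defines (up to a null set) an $\ell^p(\mathbb N)$-valued random variable; let $\mu$ be its distribution. Let $T$ be the bounded weighted backward shift on $\ell^p(\mathbb N)$ with $Te_0=0$, $Te_{n+1}=\omega_ne_n$ for $n\ge0$, and let $T^*$ be its adjoint on the dual space, where the dual pairing is $\langle z,x^*\rangle=x^*(z)$. Let $(a_j)_{j\ge0},(b_l)_{l\ge0}$ be complex sequences with $\sum_j|a_j|<\infty$, $\sum_l|b_l|<\infty$ and $\sum_{j}|a_j|\,\|T\|^{jp/2}<\infty$. Let $\phi\neq\psi$ be two distinct functions among $\operatorname{Re},-\operatorname{Re},\operatorname{Im},-\operatorname{Im}$, let $x^*,y^*\in(\ell^p(\mathbb N))^*$, and set $$f(z):=\sum_{j=0}^\infty a_je^{i\phi(\langle z,T^{*j}x^*\rangle)},\qquad g(z):=\sum_{l=0}^\infty b_le^{i\psi(\langle z,T^{*l}y^*\rangle)} .$$ Then both series converge absolutely for every $z$, and $f,g\in L^2(\mu)$. If moreover $T$ is (strongly) mixing with respect to $\mu$, i.e. $\mu(A\cap T^{-n}B)\to\mu(A)\mu(B)$ as $n\to\infty$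 for all Borel sets $A,B$, then there is a constant $C>0$, not depending on $n$ (but possibly on $f,g,\mu,T$), such that $$I_n(f,g):=\int f(z)\,g(T^nz)\,\mu(dz)-\int f\,d\mu\int g\,d\mu$$ satisfies $$|I_n(f,g)|\le C\sum_{l=0}^\infty|b_l|\sum_{j=0}^\infty k_j^{p/2}k_{j+l+n}^{p/2}\qquad\text{for all } n\ge0 .$$ -/

import Mathlib

open MeasureTheory ProbabilityTheory Filter Topology
open scoped ENNReal

namespace TemperedShift

noncomputable section

/-- The space `ℓ^p(ℕ)` of complex sequences. -/
abbrev SeqSpace (p : ℝ≥0∞) : Type := lp (fun _ : ℕ => ℂ) p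

/-- The canonical basis vectors of `ℓ^p(ℕ)`. -/
def basisVec (p : ℝ≥0∞) (n : ℕ) : SeqSpace p := lp.single p n (1 : ℂ)

/-! ### Tempered stable laws on the real line -/

/-- The truncation function `κ(x) = 1` for `|x| < 1`, `κ(x) = 1/|x|` for `|x| ≥ 1`. -/
def truncKappa (x : ℝ) : ℝ := if |x| < 1 then 1 else 1 / |x|

/-- The density of the tempered stable Lévy measure:
`aNeg e^{-lNeg |x|} / |x|^{1+α}` for `x < 0` and `aPos e^{-lPos x} / x^{1+α}` for `x > 0`. -/
def levyDensity (α aNeg aPos lNeg lPos x : ℝ) : ℝ :=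
  if x < 0 then aNeg * Real.exp (-lNeg * |x|) / |x| ^ (1 + α)
  else if 0 < x then aPos * Real.exp (-lPos * x) / x ^ (1 + α)
  else 0

/-- The tempered stable Lévy measure on `ℝ`. -/
def levyMeasure (α aNeg aPos lNeg lPos : ℝ) : Measure ℝ :=
  volume.withDensity fun x => ENNReal.ofReal (levyDensity α aNeg aPos lNeg lPos x)

/-- The law `ν` is the (centered) tempered stable law: its characteristic function is
`t ↦ exp (∫ (e^{itx} - 1 - i κ(x) t x) λ(dx))`, with `λ` the tempered stable Lévy measure. -/
def IsTemperedStable (α aNeg aPos lNeg lPos : ℝ) (ν : Measure ℝ) : Prop :=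
  ∀ t : ℝ, charFun ν t =
    Complex.exp (∫ x : ℝ,
      (Complex.exp (Complex.I * t * x) - 1 - Complex.I * truncKappa x * t * x)
        ∂(levyMeasure α aNeg aPos lNeg lPos))

/-! ### The coefficients, the random series and its law -/

/-- `k_n = k_0 ∏_{l < n} 1 / w_l`. -/
def coeff (k₀ : ℝ) (w : ℕ → ℝ) (n : ℕ) : ℝ := k₀ * ∏ l ∈ Finset.range n, 1 / w l

/-- The `n`-th term `k_n (θ_{1,n} + i θ_{2,n}) e_n` of the random series
(`θ 0` and `θ 1` are the two sequences). -/
def seriesTerm {Ω : Type*} (p : ℝ≥0∞) (k : ℕ → ℝ) (θ : Fin 2 → ℕ → Ω → ℝ) (ω : Ω) (n : ℕ) :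
    SeqSpace p :=
  ((k n : ℂ) * ((θ 0 n ω : ℂ) + Complex.I * (θ 1 n ω : ℂ))) • basisVec p n

/-- The random series `∑_n k_n (θ_{1,n} + i θ_{2,n}) e_n` in `ℓ^p(ℕ)`. -/
def randomSeries {Ω : Type*} (p : ℝ≥0∞) [Fact (1 ≤ p)] (k : ℕ → ℝ) (θ : Fin 2 → ℕ → Ω → ℝ)
    (ω : Ω) : SeqSpace p :=
  ∑' n, seriesTerm p k θ ω n

/-! ### The weighted backward shift -/

theorem memℓp_shift {p : ℝ≥0∞} (w : ℕ → ℝ) {C : ℝ} (hw : ∀ n, |w n| ≤ C) (z : SeqSpace p) :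
    Memℓp (fun n => (w n : ℂ) * z (n + 1)) p := by
  have hC : 0 ≤ C := (abs_nonneg _).trans (hw 0)
  have hb : ∀ n, ‖(w n : ℂ) * z (n + 1)‖ ≤ C * ‖z (n + 1)‖ := fun n => by
    rw [norm_mul, Complex.norm_real, Real.norm_eq_abs]
    exact mul_le_mul_of_nonneg_right (hw n) (norm_nonneg _)
  rcases p.trichotomy with (rfl | rfl | hp)
  · have h := memℓp_zero_iff.1 (lp.memℓp z)
    refine memℓp_zero ((h.preimage ((add_left_injective 1).injOn)).subset ?_)
    intro n hn
    exact right_ne_zero_of_mul hn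
  · obtain ⟨B, hB⟩ := memℓp_infty_iff.1 (lp.memℓp z)
    refine memℓp_infty ⟨C * B, ?_⟩
    rintro _ ⟨n, rfl⟩
    exact (hb n).trans (mul_le_mul_of_nonneg_left (hB ⟨n + 1, rfl⟩) hC)
  · have h := (lp.memℓp z).summable hp
    refine memℓp_gen (Summable.of_nonneg_of_le (fun n => by positivity) (fun n => ?_)
      (((summable_nat_add_iff 1).2 h).mul_left (C ^ p.toReal)))
    rw [← Real.mul_rpow hC (norm_nonneg _)]
    exact Real.rpow_le_rpow (norm_nonneg _) (hb n) hp.le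

theorem norm_shift_le {p : ℝ≥0∞} [Fact (1 ≤ p)] (w : ℕ → ℝ) {C : ℝ} (hw : ∀ n, |w n| ≤ C)
    (z : SeqSpace p) :
    ‖(⟨fun n => (w n : ℂ) * z (n + 1), memℓp_shift w hw z⟩ : SeqSpace p)‖ ≤ C * ‖z‖ := by
  have hC : 0 ≤ C := (abs_nonneg _).trans (hw 0)
  have hb : ∀ n, ‖(w n : ℂ) * z (n + 1)‖ ≤ C * ‖z (n + 1)‖ := fun n => by
    rw [norm_mul, Complex.norm_real, Real.norm_eq_abs]
    exact mul_le_mul_of_nonneg_right (hw n) (norm_nonneg _)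
  have hp0 : p ≠ 0 := (zero_lt_one.trans_le (Fact.out : 1 ≤ p)).ne'
  rcases p.trichotomy with (rfl | rfl | hp)
  · exact absurd rfl hp0
  · refine lp.norm_le_of_forall_le (by positivity) fun n => ?_
    exact (hb n).trans (mul_le_mul_of_nonneg_left (lp.norm_apply_le_norm hp0 z (n + 1)) hC)
  · refine lp.norm_le_of_tsum_le hp (by positivity) ?_
    have h := (lp.memℓp z).summable hp
    have h1 := (summable_nat_add_iff 1).2 h
    rw [Real.mul_rpow hC (norm_nonneg _), lp.norm_rpow_eq_tsum hp z]
    calc ∑' n, ‖(w n : ℂ) * z (n + 1)‖ ^ p.toReal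
        ≤ ∑' n, C ^ p.toReal * ‖z (n + 1)‖ ^ p.toReal := by
          refine Summable.tsum_le_tsum (fun n => ?_) ((memℓp_shift w hw z).summable hp)
            (h1.mul_left _)
          rw [← Real.mul_rpow hC (norm_nonneg _)]
          exact Real.rpow_le_rpow (norm_nonneg _) (hb n) hp.le
      _ = C ^ p.toReal * ∑' n, ‖z (n + 1)‖ ^ p.toReal := tsum_mul_left
      _ ≤ C ^ p.toReal * ∑' n, ‖z n‖ ^ p.toReal := by
          refine mul_le_mul_of_nonneg_left ?_ (by positivity)
          rw [h.tsum_eq_zero_add]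
          exact le_add_of_nonneg_left (by positivity)

/-- The bounded weighted backward shift `(T z)_n = w_n z_{n+1}` on `ℓ^p(ℕ)`, for a bounded weight
sequence `w`. -/
def backwardShift (p : ℝ≥0∞) [Fact (1 ≤ p)] (w : ℕ → ℝ) (hw : ∃ C, ∀ n, |w n| ≤ C) :
    SeqSpace p →L[ℂ] SeqSpace p :=
  LinearMap.mkContinuousOfExistsBound
    { toFun := fun z => ⟨fun n => (w n : ℂ) * z (n + 1), memℓp_shift w hw.choose_spec z⟩
      map_add' := fun x y => by
        ext n
        exact mul_add (w n : ℂ) (x (n + 1)) (y (n + 1))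
      map_smul' := fun c x => by
        ext n
        exact mul_left_comm (w n : ℂ) c (x (n + 1)) }
    ⟨hw.choose, fun z => norm_shift_le w hw.choose_spec z⟩

theorem backwardShift_apply (p : ℝ≥0∞) [Fact (1 ≤ p)] (w : ℕ → ℝ) (hw : ∃ C, ∀ n, |w n| ≤ C)
    (z : SeqSpace p) (n : ℕ) : backwardShift p w hw z n = (w n : ℂ) * z (n + 1) := rfl

/-- `T e_0 = 0`. -/
theorem backwardShift_basisVec_zero (p : ℝ≥0∞) [Fact (1 ≤ p)] (w : ℕ → ℝ)
    (hw : ∃ C, ∀ n, |w n| ≤ C) : backwardShift p w hw (basisVec p 0) = 0 := by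
  ext n
  rw [backwardShift_apply]
  simp [basisVec]

/-- `T e_{n+1} = w_n e_n`. -/
theorem backwardShift_basisVec_succ (p : ℝ≥0∞) [Fact (1 ≤ p)] (w : ℕ → ℝ)
    (hw : ∃ C, ∀ n, |w n| ≤ C) (n : ℕ) :
    backwardShift p w hw (basisVec p (n + 1)) = (w n : ℂ) • basisVec p n := by
  ext m
  change (w m : ℂ) * basisVec p (n + 1) (m + 1) = (w n : ℂ) * basisVec p n m
  by_cases h : m = n
  · subst h
    simp [basisVec]
  · simp [basisVec, h]

/-! ### Mixing, exponential series and correlations -/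

section General

variable {E : Type*} [NormedAddCommGroup E] [NormedSpace ℂ E]

/-- The adjoint `T^* : E^* → E^*`, `⟨z, T^* x^*⟩ = ⟨T z, x^*⟩`, for the (bilinear) duality pairing
`⟨z, x^*⟩ = x^* z` of `E` with its continuous dual. -/
def dualOp (T : E →L[ℂ] E) : StrongDual ℂ E →L[ℂ] StrongDual ℂ E :=
  ContinuousLinearMap.precomp ℂ T

/-- The term `a_j exp (i φ(⟨z, T^{*j} x^*⟩))`. -/
def expTerm (T : E →L[ℂ] E) (φ : ℂ → ℝ) (a : ℕ → ℂ) (xs : StrongDual ℂ E) (z : E) (j : ℕ) : ℂ :=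
  a j * Complex.exp (Complex.I * (φ (((dualOp T ^ j) xs) z) : ℂ))

/-- The exponential series `z ↦ ∑_j a_j exp (i φ(⟨z, T^{*j} x^*⟩))`. -/
def expSeries (T : E →L[ℂ] E) (φ : ℂ → ℝ) (a : ℕ → ℂ) (xs : StrongDual ℂ E) (z : E) : ℂ :=
  ∑' j, expTerm T φ a xs z j

variable [MeasurableSpace E]

/-- Strong mixing of the map `T` under `μ`: `μ (A ∩ T⁻ⁿ B) → μ A * μ B` for all measurable `A`, `B`.
The invariance of `μ`, which usually accompanies this notion, is not asked for here. -/
def IsStronglyMixing (T : E →L[ℂ] E) (μ : Measure E) : Prop :=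
  ∀ A B : Set E, MeasurableSet A → MeasurableSet B →
    Tendsto (fun n : ℕ => μ (A ∩ (fun z => (T ^ n) z) ⁻¹' B)) atTop (𝓝 (μ A * μ B))

/-- `I_n(f, g) = ∫ f(z) g(Tⁿ z) μ(dz) - ∫ f dμ ∫ g dμ`. -/
def correlation (T : E →L[ℂ] E) (μ : Measure E) (n : ℕ) (f g : E → ℂ) : ℂ :=
  (∫ z, f z * g ((T ^ n) z) ∂μ) - (∫ z, f z ∂μ) * ∫ z, g z ∂μ

end General

/-- The four functions `Re, -Re, Im, -Im`. -/
def partFunctions : Set (ℂ → ℝ) :=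
  {fun z => z.re, fun z => -z.re, fun z => z.im, fun z => -z.im}

end

end TemperedShift

open TemperedShift

namespace TemperedShift

/-! ### Second moments of tempered stable laws -/

/-! Under `μ`, each exponential in `f` or `g` is `e^{iX}` with `X` a real linear series in the
independent variables `θ i n`. Independence turns the covariance of `e^{iX}` and `e^{iY}` into a
difference of two products over coordinates. Telescoping bounds it by the sum of the one-coordinate
covariances (`norm_prod_sub_prod_le_sum`, `norm_bilinCov_expI_sum_le`). With coefficients `s` and
`t`, such a covariance is at most a constant times `|s|^ρ |t|^ρ` for `0 < ρ ≤ 1`, because `|e^{ix} -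
1| ≤ 2|x|^ρ` and the `θ i n` have uniformly bounded second moments (`norm_bilinCov_expI_smul_le`).
The choice `ρ = p/2` gives the stated exponents.

The coefficients are controlled in two ways. For `T^{*j} x^*` the operator norm gives `‖x^*‖ ‖T‖^j
k_m`. For `T^{*N} y^*` the identity `T^N (k_{m+N} e_{m+N}) = k_m e_m` gives `‖y^*‖ k_{m-N}`, and `0`
if `m < N`, with no power of `‖T‖`. Summing over `m` yields `∑ k_m^ρ k_{m+N}^ρ`. With `N = l + n`,
summation against `a_j ‖T‖^{jρ}` and `b_l` gives the rate. Mixing enters only through the invariance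
of `μ`, which replaces `∫ g` by `∫ g ∘ T^n`.

The moment bound is read off the characteristic function: the Lévy measure integrates `|x|` and
`x^2`, so `1 - Re` of the characteristic function is `O(t^2)`, and Fatou's lemma concludes. -/

theorem integrable_sq_of_one_sub_re_charFun_le {ν : Measure ℝ} [IsProbabilityMeasure ν] {C : ℝ}
    (h : ∀ t : ℝ, 1 - (charFun ν t).re ≤ C * t ^ 2) :
    Integrable (fun x : ℝ => x ^ 2) ν ∧ ∫ x : ℝ, x ^ 2 ∂ν ≤ Real.pi ^ 2 / 2 * C := by
  have hC : 0 ≤ C := by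
    have h1 := h 1
    have h2 : (charFun ν 1).re ≤ 1 := (Complex.re_le_norm _).trans (norm_charFun_le_one 1)
    linarith
  have hcos : ∀ t : ℝ, Integrable (fun x : ℝ => Real.cos (t * x)) ν := fun t =>
    (integrable_const (1 : ℝ)).mono' (by fun_prop)
      (Eventually.of_forall fun x => Real.abs_cos_le_one _)
  have hre : ∀ t : ℝ, (charFun ν t).re = ∫ x : ℝ, Real.cos (t * x) ∂ν := by
    intro t
    have hi : Integrable (fun x : ℝ => Complex.exp (t * x * Complex.I)) ν := by
      refine (integrable_const (1 : ℝ)).mono' (by fun_prop) (Eventually.of_forall fun x => ?_)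
      rw [← Complex.ofReal_mul, Complex.norm_exp_ofReal_mul_I]
    have h1 : (charFun ν t).re = RCLike.re (∫ x : ℝ, Complex.exp (t * x * Complex.I) ∂ν) := by
      rw [charFun_apply_real]; rfl
    rw [h1, ← integral_re hi]
    refine integral_congr_ae (Eventually.of_forall fun x => ?_)
    change (Complex.exp (t * x * Complex.I)).re = _
    rw [← Complex.ofReal_mul, Complex.exp_ofReal_mul_I_re]
  -- The integral of `F n` is the hypothesis at `t = 1/(n+1)`, rescaled. Since `cos y ≤ 1 - (2/π²)
  -- y²` for `|y| ≤ π`, the factor `π²/2` makes `F n x ≥ x²` as soon as `n ≥ |x|`, and Fatou's lemma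
  -- applies.
  let F : ℕ → ℝ → ℝ := fun n x =>
    Real.pi ^ 2 / 2 * (n + 1 : ℝ) ^ 2 * (1 - Real.cos ((n + 1 : ℝ)⁻¹ * x))
  have hF0 : ∀ n x, 0 ≤ F n x := fun n x =>
    mul_nonneg (by positivity) (sub_nonneg.2 (Real.cos_le_one _))
  have hFi : ∀ n, Integrable (F n) ν := fun n =>
    ((integrable_const (1 : ℝ)).sub (hcos _)).const_mul _
  have hFint : ∀ n, ∫⁻ x, ENNReal.ofReal (F n x) ∂ν ≤ ENNReal.ofReal (Real.pi ^ 2 / 2 * C) := by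
    intro n
    rw [← ofReal_integral_eq_lintegral_ofReal (hFi n) (Eventually.of_forall (hF0 n))]
    refine ENNReal.ofReal_le_ofReal ?_
    have h1 : ∫ x, F n x ∂ν
        = Real.pi ^ 2 / 2 * (n + 1 : ℝ) ^ 2 * (1 - (charFun ν ((n + 1 : ℝ)⁻¹)).re) := by
      rw [hre, integral_const_mul, integral_sub (integrable_const _) (hcos _)]
      simp
    rw [h1]
    calc _ ≤ Real.pi ^ 2 / 2 * (n + 1 : ℝ) ^ 2 * (C * ((n + 1 : ℝ)⁻¹) ^ 2) :=
          mul_le_mul_of_nonneg_left (h _) (by positivity)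
      _ = Real.pi ^ 2 / 2 * C := by field_simp
  have hlow : ∀ x : ℝ,
      ENNReal.ofReal (x ^ 2) ≤ liminf (fun n : ℕ => ENNReal.ofReal (F n x)) atTop := by
    intro x
    refine le_liminf_of_le (by isBoundedDefault) ?_
    obtain ⟨N, hN⟩ := exists_nat_ge |x|
    filter_upwards [eventually_ge_atTop N] with n hn
    refine ENNReal.ofReal_le_ofReal ?_
    have hn1 : (N : ℝ) ≤ n := by exact_mod_cast hn
    have hx : |(n + 1 : ℝ)⁻¹ * x| ≤ Real.pi := by
      rw [abs_mul, abs_of_pos (by positivity : (0 : ℝ) < (n + 1 : ℝ)⁻¹), inv_mul_le_iff₀ (by positivity)]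
      nlinarith [Real.pi_gt_three]
    have h1 := Real.cos_le_one_sub_mul_cos_sq hx
    calc x ^ 2 = Real.pi ^ 2 / 2 * (n + 1 : ℝ) ^ 2 *
          (2 / Real.pi ^ 2 * ((n + 1 : ℝ)⁻¹ * x) ^ 2) := by field_simp
      _ ≤ F n x := mul_le_mul_of_nonneg_left (by linarith) (by positivity)
  have hle : ∫⁻ x : ℝ, ENNReal.ofReal (x ^ 2) ∂ν ≤ ENNReal.ofReal (Real.pi ^ 2 / 2 * C) := by
    refine (lintegral_mono hlow).trans ((lintegral_liminf_le fun n => by fun_prop).trans ?_)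
    exact liminf_le_of_frequently_le' (Frequently.of_forall hFint)
  have hint : Integrable (fun x : ℝ => x ^ 2) ν := by
    refine ⟨by fun_prop, ?_⟩
    rw [hasFiniteIntegral_iff_ofReal (Eventually.of_forall fun x => sq_nonneg x)]
    exact hle.trans_lt ENNReal.ofReal_lt_top
  refine ⟨hint, ?_⟩
  rw [← ofReal_integral_eq_lintegral_ofReal hint (Eventually.of_forall fun x => sq_nonneg x)] at hle
  exact (ENNReal.ofReal_le_ofReal_iff (by positivity)).1 hle

theorem measurable_levyDensity (α aNeg aPos lNeg lPos : ℝ) :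
    Measurable (levyDensity α aNeg aPos lNeg lPos) := by
  unfold levyDensity
  refine Measurable.ite measurableSet_Iio (by fun_prop) ?_
  exact Measurable.ite measurableSet_Ioi (by fun_prop) measurable_const

/-- Against Lebesgue measure the integrand is `|x|^{s-1-α} e^{-l|x|}` on each half-line, a Gamma
integral whose exponent exceeds `-1`. Since `α < 1`, both `s = 1` and `s = 2` are allowed. -/
theorem integrable_abs_rpow_levyMeasure {α aNeg aPos lNeg lPos s : ℝ} (hs : α < s)
    (haNeg : 0 < aNeg) (haPos : 0 < aPos) (hlNeg : 0 < lNeg) (hlPos : 0 < lPos) :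
    Integrable (fun x : ℝ => |x| ^ s) (levyMeasure α aNeg aPos lNeg lPos) := by
  have hd0 : ∀ x, 0 ≤ levyDensity α aNeg aPos lNeg lPos x := by
    intro x
    unfold levyDensity
    split_ifs <;> positivity
  have key : ∀ l : ℝ, 0 < l →
      IntegrableOn (fun x : ℝ => x ^ (s - 1 - α) * Real.exp (-l * x)) (Set.Ioi 0) := by
    intro l hl
    simpa using integrableOn_rpow_mul_exp_neg_mul_rpow (p := 1) (s := s - 1 - α) (b := l)
      (by linarith) one_pos hl
  have hpow : ∀ x a l : ℝ, 0 < x →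
      x ^ s * (a * Real.exp (-l * x) / x ^ (1 + α)) =
        a * (x ^ (s - 1 - α) * Real.exp (-l * x)) := by
    intro x a l hx
    rw [show s - 1 - α = s - (1 + α) by ring, Real.rpow_sub hx]
    ring
  unfold levyMeasure
  rw [integrable_withDensity_iff (measurable_levyDensity ..).ennreal_ofReal
    (Eventually.of_forall fun x => ENNReal.ofReal_lt_top)]
  simp only [ENNReal.toReal_ofReal (hd0 _)]
  rw [← integrableOn_univ, ← @Set.Iio_union_Ici _ _ (0 : ℝ), integrableOn_union,
    integrableOn_Ici_iff_integrableOn_Ioi]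
  refine ⟨?_, ?_⟩
  · rw [← (Measure.measurePreserving_neg (volume : Measure ℝ)).integrableOn_comp_preimage
      (Homeomorph.neg ℝ).measurableEmbedding]
    simp only [Function.comp_def, Set.neg_preimage, Set.neg_Iio, neg_zero]
    refine IntegrableOn.congr_fun (Integrable.const_mul (key lNeg hlNeg) aNeg) (fun x hx => ?_) measurableSet_Ioi
    have hx : 0 < x := hx
    simp only [levyDensity, neg_lt_zero, hx, if_true, abs_neg, abs_of_pos hx]
    exact (hpow x aNeg lNeg hx).symm
  · refine IntegrableOn.congr_fun (Integrable.const_mul (key lPos hlPos) aPos) (fun x hx => ?_) measurableSet_Ioi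
    have hx : 0 < x := hx
    simp only [levyDensity, hx, if_true, abs_of_pos hx, not_lt.2 hx.le, if_false]
    exact (hpow x aPos lPos hx).symm

/-- The Lévy exponent has imaginary part of linear and real part of quadratic growth. -/
theorem exists_levyExponent_bound {α aNeg aPos lNeg lPos : ℝ} (hα : α < 1)
    (haNeg : 0 < aNeg) (haPos : 0 < aPos) (hlNeg : 0 < lNeg) (hlPos : 0 < lPos) :
    ∃ A B : ℝ, ∀ t : ℝ, ∀ Ψ : ℂ, Ψ = (∫ x : ℝ,
      (Complex.exp (Complex.I * t * x) - 1 - Complex.I * truncKappa x * t * x)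
        ∂(levyMeasure α aNeg aPos lNeg lPos)) →
      Ψ.re ≤ 0 ∧ -Ψ.re ≤ A * t ^ 2 ∧ |Ψ.im| ≤ B * |t| := by
  set m := levyMeasure α aNeg aPos lNeg lPos
  have i1 : Integrable (fun x : ℝ => |x|) m := by
    simpa using integrable_abs_rpow_levyMeasure (s := 1) hα haNeg haPos hlNeg hlPos
  have i2 : Integrable (fun x : ℝ => x ^ 2) m := by
    simpa using integrable_abs_rpow_levyMeasure (s := 2) (by linarith) haNeg haPos hlNeg hlPos
  refine ⟨∫ x : ℝ, x ^ 2 ∂m, 2 * ∫ x : ℝ, |x| ∂m, fun t Ψ hΨ => ?_⟩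
  have hA : 0 ≤ ∫ x : ℝ, x ^ 2 ∂m := integral_nonneg fun x => sq_nonneg x
  have hB : 0 ≤ ∫ x : ℝ, |x| ∂m := integral_nonneg fun x => abs_nonneg x
  by_cases hi : Integrable (fun x : ℝ =>
    Complex.exp (Complex.I * t * x) - 1 - Complex.I * truncKappa x * t * x) m
  · have hF : ∀ x : ℝ, Complex.exp (Complex.I * t * x) - 1 - Complex.I * truncKappa x * t * x
        = ⟨Real.cos (t * x) - 1, Real.sin (t * x) - truncKappa x * t * x⟩ := by
      intro x
      have h1 : Complex.I * t * x = ((t * x : ℝ) : ℂ) * Complex.I := by push_cast; ring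
      have h2 : Complex.I * truncKappa x * t * x
          = ((truncKappa x * t * x : ℝ) : ℂ) * Complex.I := by push_cast; ring
      rw [h1, h2]
      apply Complex.ext <;>
        simp [Complex.exp_ofReal_mul_I_re, Complex.exp_ofReal_mul_I_im, -Complex.ofReal_mul]
    have hre : Ψ.re = ∫ x : ℝ, (Real.cos (t * x) - 1) ∂m := by
      have h1 : Ψ.re = RCLike.re Ψ := rfl
      rw [h1, hΨ, ← integral_re hi]
      refine integral_congr_ae (Eventually.of_forall fun x => ?_)
      change (Complex.exp (Complex.I * t * x) - 1 - Complex.I * truncKappa x * t * x).re = _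
      rw [hF]
    have him : Ψ.im = ∫ x : ℝ, (Real.sin (t * x) - truncKappa x * t * x) ∂m := by
      have h1 : Ψ.im = RCLike.im Ψ := rfl
      rw [h1, hΨ, ← integral_im hi]
      refine integral_congr_ae (Eventually.of_forall fun x => ?_)
      change (Complex.exp (Complex.I * t * x) - 1 - Complex.I * truncKappa x * t * x).im = _
      rw [hF]
    refine ⟨?_, ?_, ?_⟩
    · rw [hre]
      exact integral_nonpos fun x => sub_nonpos.2 (Real.cos_le_one _)
    · rw [hre, ← integral_neg, mul_comm, ← integral_const_mul]
      refine integral_mono_of_nonneg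
        (Eventually.of_forall fun x => ?_) (i2.const_mul _) (Eventually.of_forall fun x => ?_)
      · simpa using Real.cos_le_one (t * x)
      · have := Real.one_sub_sq_div_two_le_cos (x := t * x)
        simp only
        nlinarith [sq_nonneg (t * x)]
    · rw [him, mul_comm, ← mul_assoc, ← integral_const_mul, ← Real.norm_eq_abs]
      refine norm_integral_le_of_norm_le (i1.const_mul _) (Eventually.of_forall fun x => ?_)
      have hk : |truncKappa x| ≤ 1 := by
        unfold truncKappa
        split_ifs with h
        · simp
        · rw [abs_of_nonneg (by positivity)]
          exact div_le_one_of_le₀ (not_lt.1 h) (abs_nonneg x)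
      have h1 : |Real.sin (t * x)| ≤ |t| * |x| := by
        rw [← abs_mul]; exact Real.abs_sin_le_abs
      have h2 : |truncKappa x * t * x| ≤ |t| * |x| := by
        rw [mul_assoc, abs_mul, abs_mul t x]
        exact mul_le_of_le_one_left (by positivity) hk
      calc _ ≤ |Real.sin (t * x)| + |truncKappa x * t * x| := abs_sub _ _
        _ ≤ _ := by linarith
  -- Without integrability the Bochner integral is `0` by convention and the bounds are trivial, so
  -- integrability of the integrand need not be proved.
  · rw [integral_undef hi] at hΨ
    subst hΨ
    simp only [Complex.zero_re, Complex.zero_im, abs_zero, neg_zero, le_refl, true_and]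
    constructor <;> positivity

/-- Writing `u = a + ib` with `a ≤ 0`, one has `e^a cos b ≥ e^a (1 - b²/2) ≥ 1 + a - b²/2`, using
`e^a ≤ 1` in the last term. -/
theorem one_sub_exp_re_le {u : ℂ} (hu : u.re ≤ 0) :
    1 - (Complex.exp u).re ≤ -u.re + u.im ^ 2 / 2 := by
  rw [Complex.exp_re]
  have h1 := Real.add_one_le_exp u.re
  have h2 : Real.exp u.re ≤ 1 := Real.exp_le_one_iff.2 hu
  have h3 := Real.one_sub_sq_div_two_le_cos (x := u.im)
  have h4 := Real.exp_pos u.re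
  nlinarith [sq_nonneg u.im]

/-- Tempered stable laws have second moments, bounded in terms of the parameters. -/
theorem exists_integral_sq_le_of_isTemperedStable {α aNeg aPos lNeg lPos : ℝ} (hα : α < 1)
    (haNeg : 0 < aNeg) (haPos : 0 < aPos) (hlNeg : 0 < lNeg) (hlPos : 0 < lPos) :
    ∃ M : ℝ, ∀ (ν : Measure ℝ) [IsProbabilityMeasure ν],
      IsTemperedStable α aNeg aPos lNeg lPos ν →
      Integrable (fun x : ℝ => x ^ 2) ν ∧ ∫ x : ℝ, x ^ 2 ∂ν ≤ M := by
  obtain ⟨A, B, hAB⟩ := exists_levyExponent_bound hα haNeg haPos hlNeg hlPos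
  refine ⟨Real.pi ^ 2 / 2 * (A + B ^ 2 / 2), fun ν _ hν =>
    integrable_sq_of_one_sub_re_charFun_le fun t => ?_⟩
  obtain ⟨h1, h2, h3⟩ := hAB t _ rfl
  rw [hν t]
  refine (one_sub_exp_re_le h1).trans ?_
  have h4 := pow_le_pow_left₀ (abs_nonneg _) h3 2
  rw [sq_abs, mul_pow, sq_abs] at h4
  linarith

end TemperedShift

namespace TemperedShift

/-! ### Covariances of bounded complex functions -/

section Covariance

variable {Ω : Type*} [MeasurableSpace Ω] {P : Measure Ω}

/-- The bilinear covariance `∫ F G - ∫ F ∫ G` of complex functions. -/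
noncomputable def bilinCov (P : Measure Ω) (F G : Ω → ℂ) : ℂ :=
  (∫ ω, F ω * G ω ∂P) - (∫ ω, F ω ∂P) * ∫ ω, G ω ∂P

theorem bilinCov_comm (F G : Ω → ℂ) : bilinCov P F G = bilinCov P G F := by
  simp only [bilinCov, mul_comm]

theorem integrable_of_norm_le_const [IsFiniteMeasure P] {F : Ω → ℂ}
    (hF : AEStronglyMeasurable F P) {C : ℝ} (h : ∀ ω, ‖F ω‖ ≤ C) : Integrable F P :=
  (integrable_const C).mono' hF (Eventually.of_forall h)

theorem bilinCov_const_mul (c : ℂ) (F G : Ω → ℂ) :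
    bilinCov P (fun ω => c * F ω) G = c * bilinCov P F G := by
  simp only [bilinCov, mul_assoc, integral_const_mul]
  ring

/-- Covariance is not changed by subtracting constants. -/
theorem bilinCov_sub_one [IsProbabilityMeasure P] {F G : Ω → ℂ} (hF : Integrable F P)
    (hG : Integrable G P) (hFG : Integrable (fun ω => F ω * G ω) P) :
    bilinCov P (fun ω => F ω - 1) (fun ω => G ω - 1) = bilinCov P F G := by
  have h : ∀ ω, (F ω - 1) * (G ω - 1) = F ω * G ω - F ω - G ω + 1 := fun ω => by ring
  simp only [bilinCov, h]
  have h1 : Integrable (fun ω => F ω * G ω - F ω) P := hFG.sub hF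
  have h2 : Integrable (fun ω => F ω * G ω - F ω - G ω) P := h1.sub hG
  rw [integral_add h2 (integrable_const _), integral_sub h1 hG,
    integral_sub hFG hF, integral_sub hF (integrable_const _), integral_sub hG (integrable_const _)]
  simp
  ring

/-- The summable sup bounds `c` justify exchanging sum and integral. By symmetry of the covariance
this serves for the series of `f` and for that of `g`. -/
theorem norm_bilinCov_tsum_le [IsFiniteMeasure P] {F : ℕ → Ω → ℂ} {G : Ω → ℂ} {c d : ℕ → ℝ}
    {C : ℝ} (hF : ∀ j, AEStronglyMeasurable (F j) P) (hG : AEStronglyMeasurable G P)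
    (hFc : ∀ j ω, ‖F j ω‖ ≤ c j) (hGC : ∀ ω, ‖G ω‖ ≤ C) (hc : Summable c)
    (hd : Summable d) (hFd : ∀ j, ‖bilinCov P (F j) G‖ ≤ d j) :
    ‖bilinCov P (fun ω => ∑' j, F j ω) G‖ ≤ ∑' j, d j := by
  have hFi : ∀ j, Integrable (F j) P := fun j => integrable_of_norm_le_const (hF j) (hFc j)
  have hFGb : ∀ j ω, ‖F j ω * G ω‖ ≤ c j * C := fun j ω => by
    rw [norm_mul]
    exact mul_le_mul (hFc j ω) (hGC ω) (norm_nonneg _) ((norm_nonneg _).trans (hFc j ω))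
  have hFGi : ∀ j, Integrable (fun ω => F j ω * G ω) P := fun j =>
    integrable_of_norm_le_const ((hF j).mul hG) (hFGb j)
  have hsum : ∀ (H : ℕ → Ω → ℂ) (e : ℕ → ℝ), (∀ j, Integrable (H j) P) →
      (∀ j ω, ‖H j ω‖ ≤ e j) → Summable e →
      HasSum (fun j => ∫ ω, H j ω ∂P) (∫ ω, ∑' j, H j ω ∂P) := by
    intro H e hH hHe he
    refine hasSum_integral_of_summable_integral_norm hH ?_
    refine Summable.of_nonneg_of_le (fun j => integral_nonneg fun ω => norm_nonneg _) (fun j => ?_)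
      (he.mul_left (P.real Set.univ))
    calc ∫ ω, ‖H j ω‖ ∂P ≤ ∫ _, e j ∂P :=
          integral_mono (hH j).norm (integrable_const _) (hHe j)
      _ = P.real Set.univ * e j := by simp
  have h1 := hsum F c hFi hFc hc
  have h2 := hsum _ _ hFGi hFGb (hc.mul_right C)
  have h3 : bilinCov P (fun ω => ∑' j, F j ω) G = ∑' j, bilinCov P (F j) G := by
    refine ((h2.sub (h1.mul_right (∫ ω, G ω ∂P))).tsum_eq.trans ?_).symm
    simp only [bilinCov, tsum_mul_right]
  rw [h3]
  exact tsum_of_norm_bounded hd.hasSum hFd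

end Covariance

/-! ### Decorrelation of exponentials of independent sums -/

section Independent

theorem norm_prod_sub_prod_le_sum {ι : Type*} (Q : Finset ι) {u v : ι → ℂ}
    (hu : ∀ q, ‖u q‖ ≤ 1) (hv : ∀ q, ‖v q‖ ≤ 1) :
    ‖∏ q ∈ Q, u q - ∏ q ∈ Q, v q‖ ≤ ∑ q ∈ Q, ‖u q - v q‖ := by
  classical
  induction Q using Finset.induction_on with
  | empty => simp
  | insert a Q ha ih =>
    rw [Finset.prod_insert ha, Finset.prod_insert ha, Finset.sum_insert ha]
    have hp : ‖∏ q ∈ Q, u q‖ ≤ 1 := by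
      rw [norm_prod]
      exact Finset.prod_le_one (fun _ _ => norm_nonneg _) fun q _ => hu q
    calc ‖u a * ∏ q ∈ Q, u q - v a * ∏ q ∈ Q, v q‖
        = ‖(u a - v a) * ∏ q ∈ Q, u q + v a * (∏ q ∈ Q, u q - ∏ q ∈ Q, v q)‖ := by
          congr 1; ring
      _ ≤ ‖u a - v a‖ * ‖∏ q ∈ Q, u q‖ + ‖v a‖ * ‖∏ q ∈ Q, u q - ∏ q ∈ Q, v q‖ := by
          refine (norm_add_le _ _).trans_eq ?_
          rw [norm_mul, norm_mul]
      _ ≤ ‖u a - v a‖ * 1 + 1 * ∑ q ∈ Q, ‖u q - v q‖ := by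
          gcongr
          exact hv a
      _ = _ := by ring

/-- The unimodular function `x ↦ e^{ix}`. -/
noncomputable def expI (x : ℝ) : ℂ := Complex.exp (Complex.I * (x : ℂ))

theorem continuous_expI : Continuous expI := by
  unfold expI
  fun_prop

theorem norm_expI (x : ℝ) : ‖expI x‖ = 1 := Complex.norm_exp_I_mul_ofReal x

theorem expI_add (x y : ℝ) : expI (x + y) = expI x * expI y := by
  simp only [expI, Complex.ofReal_add, mul_add, Complex.exp_add]

theorem expI_sum {ι : Type*} (Q : Finset ι) (x : ι → ℝ) :
    expI (∑ q ∈ Q, x q) = ∏ q ∈ Q, expI (x q) := by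
  simp only [expI, Complex.ofReal_sum, Finset.mul_sum, Complex.exp_sum]

/-- Interpolates between `|e^{ix} - 1| ≤ |x|` and `|e^{ix} - 1| ≤ 2`. -/
theorem norm_expI_sub_one_le {ρ : ℝ} (hρ : 0 < ρ) (hρ1 : ρ ≤ 1) (x : ℝ) :
    ‖expI x - 1‖ ≤ 2 * |x| ^ ρ := by
  rcases le_total |x| 1 with h | h
  · calc ‖expI x - 1‖ ≤ |x| := Real.norm_exp_I_mul_ofReal_sub_one_le
      _ ≤ |x| ^ ρ := Real.self_le_rpow_of_le_one (abs_nonneg x) h hρ1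
      _ ≤ 2 * |x| ^ ρ := by linarith [Real.rpow_nonneg (abs_nonneg x) ρ]
  · have h1 : 1 ≤ |x| ^ ρ := Real.one_le_rpow h hρ.le
    have h2 := norm_sub_le (expI x) 1
    rw [norm_expI, norm_one] at h2
    linarith

theorem rpow_abs_le_one_add_sq {r : ℝ} (hr : 0 ≤ r) (hr2 : r ≤ 2) (x : ℝ) :
    |x| ^ r ≤ 1 + x ^ 2 := by
  rcases le_total |x| 1 with h | h
  · have := Real.rpow_le_one (abs_nonneg x) h hr
    nlinarith [sq_nonneg x]
  · have := Real.rpow_le_rpow_of_exponent_le h hr2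
    rw [Real.rpow_two, sq_abs] at this
    linarith

variable {Ω : Type*} [MeasurableSpace Ω] {P : Measure Ω} {ι : Type*} {ξ : ι → Ω → ℝ}

theorem integral_expI_sum_eq_prod (hξ : ∀ q, Measurable (ξ q)) (hind : iIndepFun ξ P)
    (Q : Finset ι) (s : ι → ℝ) :
    ∫ ω, expI (∑ q ∈ Q, s q * ξ q ω) ∂P = ∏ q ∈ Q, ∫ ω, expI (s q * ξ q ω) ∂P := by
  have hQ : iIndepFun (fun q : Q => ξ q) P := hind.precomp Subtype.val_injective
  have h := hQ.integral_fun_prod_comp (f := fun (q : Q) x => expI (s q * x)) (fun q => (hξ q).aemeasurable)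
    (fun q => (continuous_expI.comp (continuous_const.mul continuous_id)).aestronglyMeasurable)
  simp only [expI_sum]
  rw [← Finset.prod_coe_sort Q fun q => ∫ ω, expI (s q * ξ q ω) ∂P]
  refine Eq.trans (integral_congr_ae (Eventually.of_forall fun ω => ?_)) h
  exact (Finset.prod_coe_sort Q fun q => expI (s q * ξ q ω)).symm

variable [IsProbabilityMeasure P]

theorem integrable_expI {X : Ω → ℝ} (hX : AEMeasurable X P) :
    Integrable (fun ω => expI (X ω)) P :=
  integrable_of_norm_le_const
    (continuous_expI.measurable.comp_aemeasurable hX).aestronglyMeasurable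
    fun _ => (norm_expI _).le

theorem norm_integral_expI_le (X : Ω → ℝ) : ‖∫ ω, expI (X ω) ∂P‖ ≤ 1 := by
  refine (norm_integral_le_of_norm_le_const (Eventually.of_forall fun ω => (norm_expI _).le)).trans ?_
  simp

/-- Subtracting `1` from both exponentials leaves the covariance unchanged and makes the factors
`O(|sξ|^ρ)` and `O(|tξ|^ρ)`. The moments of order `ρ` and `2ρ ≤ 2` are at most `1 + M`. -/
theorem norm_bilinCov_expI_smul_le {ξ : Ω → ℝ} (hξ : Measurable ξ) {M : ℝ}
    (hi : Integrable (fun ω => ξ ω ^ 2) P) (hM : ∫ ω, ξ ω ^ 2 ∂P ≤ M) {ρ : ℝ} (hρ : 0 < ρ)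
    (hρ1 : ρ ≤ 1) (s t : ℝ) :
    ‖bilinCov P (fun ω => expI (s * ξ ω)) (fun ω => expI (t * ξ ω))‖ ≤
      8 * (1 + M) ^ 2 * (|s| ^ ρ * |t| ^ ρ) := by
  have hM0 : 0 ≤ M := (integral_nonneg fun ω => sq_nonneg (ξ ω)).trans hM
  have hi1 : Integrable (fun ω => 1 + ξ ω ^ 2) P := (integrable_const _).add hi
  have hI : ∫ ω, (1 + ξ ω ^ 2) ∂P ≤ 1 + M := by
    rw [integral_add (integrable_const _) hi]
    simpa using hM
  have hb : ∀ (r : ℝ) (ω : Ω), ‖expI (r * ξ ω) - 1‖ ≤ 2 * |r| ^ ρ * |ξ ω| ^ ρ := fun r ω => by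
    refine (norm_expI_sub_one_le hρ hρ1 _).trans_eq ?_
    rw [abs_mul, Real.mul_rpow (abs_nonneg _) (abs_nonneg _), mul_assoc]
  have h1 : ∀ r : ℝ, ‖∫ ω, (expI (r * ξ ω) - 1) ∂P‖ ≤ 2 * |r| ^ ρ * (1 + M) := fun r => by
    calc _ ≤ ∫ ω, 2 * |r| ^ ρ * (1 + ξ ω ^ 2) ∂P := by
          refine norm_integral_le_of_norm_le (hi1.const_mul _) (Eventually.of_forall fun ω => ?_)
          exact (hb r ω).trans (mul_le_mul_of_nonneg_left
            (rpow_abs_le_one_add_sq hρ.le (by linarith) _) (by positivity))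
      _ ≤ _ := by
          rw [integral_const_mul]
          exact mul_le_mul_of_nonneg_left hI (by positivity)
  have h2 : ‖∫ ω, (expI (s * ξ ω) - 1) * (expI (t * ξ ω) - 1) ∂P‖ ≤
      4 * (|s| ^ ρ * |t| ^ ρ) * (1 + M) := by
    calc _ ≤ ∫ ω, 4 * (|s| ^ ρ * |t| ^ ρ) * (1 + ξ ω ^ 2) ∂P := by
          refine norm_integral_le_of_norm_le (hi1.const_mul _) (Eventually.of_forall fun ω => ?_)
          rw [norm_mul]
          refine (mul_le_mul (hb s ω) (hb t ω) (norm_nonneg _) (by positivity)).trans ?_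
          calc 2 * |s| ^ ρ * |ξ ω| ^ ρ * (2 * |t| ^ ρ * |ξ ω| ^ ρ)
              = 4 * (|s| ^ ρ * |t| ^ ρ) * |ξ ω| ^ (ρ * 2) := by
                rw [Real.rpow_mul (abs_nonneg _), Real.rpow_two]; ring
            _ ≤ _ := mul_le_mul_of_nonneg_left
                (rpow_abs_le_one_add_sq (by linarith) (by linarith) _) (by positivity)
      _ ≤ _ := by
          rw [integral_const_mul]
          exact mul_le_mul_of_nonneg_left hI (by positivity)
  have hes := integrable_expI (P := P) (hξ.const_mul s).aemeasurable
  have het := integrable_expI (P := P) (hξ.const_mul t).aemeasurable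
  have hst : Integrable (fun ω => expI (s * ξ ω) * expI (t * ξ ω)) P := by
    simp only [← expI_add]
    exact integrable_expI ((hξ.const_mul s).add (hξ.const_mul t)).aemeasurable
  rw [← bilinCov_sub_one hes het hst]
  unfold bilinCov
  refine (norm_sub_le _ _).trans ?_
  rw [norm_mul]
  have h3 := mul_le_mul (h1 s) (h1 t) (norm_nonneg _) (by positivity)
  have h4 : 0 ≤ |s| ^ ρ * |t| ^ ρ := by positivity
  -- Raising `1 + M` to its square lets the two contributions, each with constant `4`, add up to `8
  -- (1 + M)^2`.
  have h5 : 4 * (|s| ^ ρ * |t| ^ ρ) * (1 + M) ≤ 4 * (|s| ^ ρ * |t| ^ ρ) * (1 + M) ^ 2 :=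
    mul_le_mul_of_nonneg_left (by nlinarith) (by positivity)
  calc _ ≤ 4 * (|s| ^ ρ * |t| ^ ρ) * (1 + M) ^ 2
        + 2 * |s| ^ ρ * (1 + M) * (2 * |t| ^ ρ * (1 + M)) := add_le_add (h2.trans h5) h3
    _ = _ := by ring

theorem norm_bilinCov_expI_sum_le (hξ : ∀ q, Measurable (ξ q)) (hind : iIndepFun ξ P) {M : ℝ}
    (hi : ∀ q, Integrable (fun ω => ξ q ω ^ 2) P) (hM : ∀ q, ∫ ω, ξ q ω ^ 2 ∂P ≤ M) {ρ : ℝ}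
    (hρ : 0 < ρ) (hρ1 : ρ ≤ 1) (Q : Finset ι) (s t : ι → ℝ) :
    ‖bilinCov P (fun ω => expI (∑ q ∈ Q, s q * ξ q ω)) (fun ω => expI (∑ q ∈ Q, t q * ξ q ω))‖ ≤
      8 * (1 + M) ^ 2 * ∑ q ∈ Q, |s q| ^ ρ * |t q| ^ ρ := by
  have h1 : ∫ ω, expI (∑ q ∈ Q, s q * ξ q ω) * expI (∑ q ∈ Q, t q * ξ q ω) ∂P
      = ∏ q ∈ Q, ∫ ω, expI (s q * ξ q ω) * expI (t q * ξ q ω) ∂P := by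
    simp only [← expI_add, ← Finset.sum_add_distrib, ← add_mul]
    exact integral_expI_sum_eq_prod hξ hind Q fun q => s q + t q
  unfold bilinCov
  rw [h1, integral_expI_sum_eq_prod hξ hind, integral_expI_sum_eq_prod hξ hind,
    ← Finset.prod_mul_distrib, Finset.mul_sum]
  refine (norm_prod_sub_prod_le_sum Q (fun q => ?_) fun q => ?_).trans
    (Finset.sum_le_sum fun q _ => norm_bilinCov_expI_smul_le (hξ q) (hi q) (hM q) hρ hρ1 _ _)
  · simp only [← expI_add]
    exact norm_integral_expI_le _
  · rw [norm_mul]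
    exact mul_le_one₀ (norm_integral_expI_le _) (norm_nonneg _) (norm_integral_expI_le _)

theorem tendsto_integral_expI {X : ℕ → Ω → ℝ} {Y : Ω → ℝ} (hX : ∀ n, AEMeasurable (X n) P)
    (h : ∀ᵐ ω ∂P, Tendsto (fun n => X n ω) atTop (𝓝 (Y ω))) :
    Tendsto (fun n => ∫ ω, expI (X n ω) ∂P) atTop (𝓝 (∫ ω, expI (Y ω) ∂P)) := by
  refine tendsto_integral_of_dominated_convergence (fun _ => (1 : ℝ))
    (fun n => (integrable_expI (hX n)).aestronglyMeasurable) (integrable_const _)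
    (fun n => Eventually.of_forall fun ω => (norm_expI _).le) ?_
  filter_upwards [h] with ω hω
  exact (continuous_expI.tendsto _).comp hω

/-- Decorrelation for exponentials of two series in the same independent variables. -/
theorem norm_bilinCov_expI_le_of_tendsto (hξ : ∀ q, Measurable (ξ q)) (hind : iIndepFun ξ P)
    {M : ℝ} (hi : ∀ q, Integrable (fun ω => ξ q ω ^ 2) P) (hM : ∀ q, ∫ ω, ξ q ω ^ 2 ∂P ≤ M)
    {ρ : ℝ} (hρ : 0 < ρ) (hρ1 : ρ ≤ 1) {Q : ℕ → Finset ι} {s t : ι → ℝ} {X Y : Ω → ℝ}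
    (hX : ∀ᵐ ω ∂P, Tendsto (fun n => ∑ q ∈ Q n, s q * ξ q ω) atTop (𝓝 (X ω)))
    (hY : ∀ᵐ ω ∂P, Tendsto (fun n => ∑ q ∈ Q n, t q * ξ q ω) atTop (𝓝 (Y ω)))
    {S : ℝ} (hS : ∀ n, ∑ q ∈ Q n, |s q| ^ ρ * |t q| ^ ρ ≤ S) :
    ‖bilinCov P (fun ω => expI (X ω)) (fun ω => expI (Y ω))‖ ≤ 8 * (1 + M) ^ 2 * S := by
  have hm : ∀ (r : ι → ℝ) (n : ℕ), AEMeasurable (fun ω => ∑ q ∈ Q n, r q * ξ q ω) P :=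
    fun r n => (Finset.measurable_sum _ fun q _ => (hξ q).const_mul _).aemeasurable
  have hXY : ∀ᵐ ω ∂P, Tendsto (fun n => ∑ q ∈ Q n, s q * ξ q ω + ∑ q ∈ Q n, t q * ξ q ω) atTop
      (𝓝 (X ω + Y ω)) := by
    filter_upwards [hX, hY] with ω h1 h2 using h1.add h2
  have h1 := tendsto_integral_expI (fun n => (hm s n).add (hm t n)) hXY
  have h2 := (tendsto_integral_expI (hm s) hX).mul (tendsto_integral_expI (hm t) hY)
  have h3 := (h1.sub h2).norm
  simp only [Pi.add_apply, expI_add] at h3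
  refine le_of_tendsto h3 (Eventually.of_forall fun n => ?_)
  exact (norm_bilinCov_expI_sum_le hξ hind hi hM hρ hρ1 (Q n) s t).trans
    (mul_le_mul_of_nonneg_left (hS n) (by positivity))

end Independent

end TemperedShift

namespace TemperedShift

/-! ### The coefficients -/

section Coefficients

variable {k₀ : ℝ} {w : ℕ → ℝ}

theorem coeff_pos (hk₀ : 0 < k₀) (hw : ∀ n, 0 < w n) (n : ℕ) : 0 < coeff k₀ w n :=
  mul_pos hk₀ (Finset.prod_pos fun l _ => one_div_pos.2 (hw l))

theorem coeff_succ_mul (hw : ∀ n, 0 < w n) (n : ℕ) :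
    coeff k₀ w (n + 1) * w n = coeff k₀ w n := by
  have := (hw n).ne'
  unfold coeff
  rw [Finset.prod_range_succ]
  field_simp

/-- Since `k n ^ α → 0`, eventually `k n ≤ 1`, where a larger exponent gives a smaller power. The
exponent `1` serves almost sure convergence, the exponent `p` the rate. -/
theorem summable_rpow_of_le {k : ℕ → ℝ} (hk0 : ∀ n, 0 ≤ k n) {α r : ℝ} (hα : 0 < α) (hr : α ≤ r)
    (hk : Summable fun n => k n ^ α) : Summable fun n => k n ^ r := by
  refine hk.of_norm_bounded_eventually_nat ?_
  filter_upwards [hk.tendsto_atTop_zero.eventually (gt_mem_nhds one_pos)] with n hn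
  rw [Real.norm_of_nonneg (Real.rpow_nonneg (hk0 n) r)]
  have h1 : k n ≤ 1 := by
    by_contra h
    exact absurd hn (not_lt.2 (Real.one_le_rpow (not_le.1 h).le hα.le))
  rcases (hk0 n).eq_or_lt with h | h
  · rw [← h, Real.zero_rpow (by linarith), Real.zero_rpow hα.ne']
  · exact Real.rpow_le_rpow_of_exponent_ge h h1 hr

variable {k : ℕ → ℝ} {ρ : ℝ}

theorem rpow_mul_rpow_le (hk0 : ∀ n, 0 ≤ k n) (m N : ℕ) :
    k m ^ ρ * k (m + N) ^ ρ ≤ k m ^ (2 * ρ) + k (m + N) ^ (2 * ρ) := by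
  rw [mul_comm 2 ρ, Real.rpow_mul (hk0 m), Real.rpow_mul (hk0 (m + N)), Real.rpow_two,
    Real.rpow_two]
  nlinarith [sq_nonneg (k m ^ ρ - k (m + N) ^ ρ), sq_nonneg (k m ^ ρ), sq_nonneg (k (m + N) ^ ρ)]

theorem summable_rpow_mul_rpow_add (hk0 : ∀ n, 0 ≤ k n) (hk : Summable fun n => k n ^ (2 * ρ))
    (N : ℕ) : Summable fun m => k m ^ ρ * k (m + N) ^ ρ :=
  Summable.of_nonneg_of_le
    (fun _ => mul_nonneg (Real.rpow_nonneg (hk0 _) _) (Real.rpow_nonneg (hk0 _) _))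
    (rpow_mul_rpow_le hk0 · N)
    (hk.add ((summable_nat_add_iff (f := fun n => k n ^ (2 * ρ)) N).2 hk))

theorem tsum_rpow_mul_rpow_add_le (hk0 : ∀ n, 0 ≤ k n) (hk : Summable fun n => k n ^ (2 * ρ))
    (N : ℕ) : ∑' m, k m ^ ρ * k (m + N) ^ ρ ≤ 2 * ∑' m, k m ^ (2 * ρ) := by
  have h1 := (summable_nat_add_iff (f := fun n => k n ^ (2 * ρ)) N).2 hk
  have h2 : ∑' m, k (m + N) ^ (2 * ρ) ≤ ∑' m, k m ^ (2 * ρ) := by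
    rw [← hk.sum_add_tsum_nat_add N]
    exact le_add_of_nonneg_left (Finset.sum_nonneg fun n _ => Real.rpow_nonneg (hk0 n) _)
  calc _ ≤ ∑' m, (k m ^ (2 * ρ) + k (m + N) ^ (2 * ρ)) :=
        (summable_rpow_mul_rpow_add hk0 hk N).tsum_le_tsum (rpow_mul_rpow_le hk0 · N) (hk.add h1)
    _ = ∑' m, k m ^ (2 * ρ) + ∑' m, k (m + N) ^ (2 * ρ) := hk.tsum_add h1
    _ ≤ _ := by linarith

/-- Reindexing by `n = m + N`: the terms with `n < N` vanish because `T^N` kills those basis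
vectors. -/
theorem sum_rpow_mul_ite_le_tsum (hk0 : ∀ n, 0 ≤ k n) (hk : Summable fun n => k n ^ (2 * ρ))
    (N K : ℕ) :
    ∑ n ∈ Finset.range K, k n ^ ρ * (if n < N then 0 else k (n - N) ^ ρ) ≤
      ∑' m, k m ^ ρ * k (m + N) ^ ρ := by
  set h : ℕ → ℝ := fun n => k n ^ ρ * (if n < N then 0 else k (n - N) ^ ρ) with hh
  have hshift : ∀ m, h (m + N) = k m ^ ρ * k (m + N) ^ ρ := fun m => by
    simp [hh, mul_comm]
  have h0 : ∀ n, 0 ≤ h n := fun n => by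
    have := Real.rpow_nonneg (hk0 (n - N)) ρ
    have := Real.rpow_nonneg (hk0 n) ρ
    simp only [hh]
    split_ifs <;> positivity
  have hs : Summable h := by
    rw [← summable_nat_add_iff N]
    simpa only [hshift] using summable_rpow_mul_rpow_add hk0 hk N
  have hz : ∑ n ∈ Finset.range N, h n = 0 :=
    Finset.sum_eq_zero fun n hn => by simp [hh, Finset.mem_range.1 hn]
  calc _ ≤ ∑' n, h n := hs.sum_le_tsum _ fun n _ => h0 n
    _ = ∑' m, k m ^ ρ * k (m + N) ^ ρ := by
      rw [← hs.sum_add_tsum_nat_add N, hz, zero_add]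
      simp only [hshift]

end Coefficients

/-! ### Powers of the shift and of its adjoint -/

section Shift

variable {p : ℝ≥0∞} [Fact (1 ≤ p)]

theorem norm_basisVec (n : ℕ) : ‖basisVec p n‖ = 1 := by
  rw [basisVec, lp.norm_single (zero_lt_one.trans_le Fact.out), norm_one]

set_option synthInstance.maxHeartbeats 200000 in
theorem dualOp_pow_apply {E : Type*} [NormedAddCommGroup E] [NormedSpace ℂ E] (T : E →L[ℂ] E)
    (xs : StrongDual ℂ E) (j : ℕ) (z : E) : ((dualOp T ^ j) xs) z = xs ((T ^ j) z) := by
  induction j generalizing xs with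
  | zero => simp
  | succ j ih =>
    rw [pow_succ, mul_apply_eq_comp, ih, pow_succ', mul_apply_eq_comp]
    rfl

variable {k₀ : ℝ} {w : ℕ → ℝ} {hw : ∃ C, ∀ n, |w n| ≤ C}

theorem backwardShift_pow_basisVec_of_lt {n N : ℕ} (h : n < N) :
    (backwardShift p w hw ^ N) (basisVec p n) = 0 := by
  induction N generalizing n with
  | zero => omega
  | succ N ih =>
    rw [pow_succ, mul_apply_eq_comp]
    cases n with
    | zero => rw [backwardShift_basisVec_zero, map_zero]
    | succ n => rw [backwardShift_basisVec_succ, map_smul, ih (by omega), smul_zero]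

theorem backwardShift_pow_coeff_smul_basisVec (hwp : ∀ n, 0 < w n) (n N : ℕ) :
    (backwardShift p w hw ^ N) ((coeff k₀ w (n + N) : ℂ) • basisVec p (n + N)) =
      (coeff k₀ w n : ℂ) • basisVec p n := by
  induction N with
  | zero => simp
  | succ N ih =>
    rw [pow_succ, mul_apply_eq_comp, ← add_assoc, map_smul,
      backwardShift_basisVec_succ, smul_smul, ← Complex.ofReal_mul, coeff_succ_mul hwp, ih]

theorem norm_coeff_mul_dualOp_pow_le (hk₀ : 0 < k₀) (hwp : ∀ n, 0 < w n)
    (T : SeqSpace p →L[ℂ] SeqSpace p) (xs : StrongDual ℂ (SeqSpace p)) (j n : ℕ) :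
    ‖(coeff k₀ w n : ℂ) * ((dualOp T ^ j) xs) (basisVec p n)‖ ≤
      ‖xs‖ * ‖T‖ ^ j * coeff k₀ w n := by
  have hT : ‖(T ^ j) (basisVec p n)‖ ≤ ‖T‖ ^ j := by
    induction j with
    | zero => simp [norm_basisVec]
    | succ j ih =>
      rw [pow_succ', pow_succ', mul_apply_eq_comp]
      exact (T.le_opNorm _).trans (mul_le_mul_of_nonneg_left ih (norm_nonneg _))
  rw [norm_mul, Complex.norm_real, Real.norm_of_nonneg (coeff_pos hk₀ hwp n).le, mul_comm,
    dualOp_pow_apply]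
  refine mul_le_mul_of_nonneg_right ?_ (coeff_pos hk₀ hwp n).le
  exact (xs.le_opNorm _).trans (mul_le_mul_of_nonneg_left hT (norm_nonneg _))

/-- The weights cancel exactly against the coefficients, so no factor `‖T‖^N` appears. This is the
source of the decay in `n`. -/
theorem norm_coeff_mul_dualOp_backwardShift_pow_le (hk₀ : 0 < k₀) (hwp : ∀ n, 0 < w n)
    (ys : StrongDual ℂ (SeqSpace p)) (N n : ℕ) :
    ‖(coeff k₀ w n : ℂ) * ((dualOp (backwardShift p w hw) ^ N) ys) (basisVec p n)‖ ≤
      ‖ys‖ * (if n < N then 0 else coeff k₀ w (n - N)) := by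
  rw [dualOp_pow_apply]
  split_ifs with h
  · simp [backwardShift_pow_basisVec_of_lt h]
  · obtain ⟨m, rfl⟩ := Nat.exists_eq_add_of_le' (not_lt.1 h)
    rw [← smul_eq_mul, ← map_smul, ← map_smul, backwardShift_pow_coeff_smul_basisVec hwp,
      Nat.add_sub_cancel]
    refine (ys.le_opNorm _).trans_eq ?_
    rw [norm_smul, norm_basisVec, mul_one, Complex.norm_real,
      Real.norm_of_nonneg (coeff_pos hk₀ hwp m).le]

end Shift

/-! ### Convergence of the random series -/

section Series

variable {Ω : Type*} {p : ℝ≥0∞} [Fact (1 ≤ p)] {k : ℕ → ℝ} {θ : Fin 2 → ℕ → Ω → ℝ}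

theorem norm_seriesTerm_le (hk0 : ∀ n, 0 ≤ k n) (ω : Ω) (n : ℕ) :
    ‖seriesTerm p k θ ω n‖ ≤ k n * (2 + θ 0 n ω ^ 2 + θ 1 n ω ^ 2) := by
  rw [seriesTerm, norm_smul, norm_basisVec, mul_one, norm_mul, Complex.norm_real,
    Real.norm_of_nonneg (hk0 n)]
  refine mul_le_mul_of_nonneg_left ((norm_add_le _ _).trans ?_) (hk0 n)
  rw [norm_mul, Complex.norm_I, one_mul, Complex.norm_real, Complex.norm_real, Real.norm_eq_abs,
    Real.norm_eq_abs]
  have h : ∀ x : ℝ, |x| ≤ 1 + x ^ 2 := fun x => by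
    simpa using rpow_abs_le_one_add_sq zero_le_one one_le_two x
  linarith [h (θ 0 n ω), h (θ 1 n ω)]

/-- Real linearity and norm at most one are the only properties of `φ` and `ψ` that the estimates
need. -/
theorem exists_continuousLinearMap_of_mem_partFunctions {φ : ℂ → ℝ} (hφ : φ ∈ partFunctions) :
    ∃ L : ℂ →L[ℝ] ℝ, (∀ z, φ z = L z) ∧ ∀ z, |L z| ≤ ‖z‖ := by
  rcases hφ with rfl | rfl | rfl | rfl
  · exact ⟨Complex.reCLM, fun _ => rfl, Complex.abs_re_le_norm⟩
  · exact ⟨-Complex.reCLM, fun _ => rfl, fun z => by simpa using Complex.abs_re_le_norm z⟩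
  · exact ⟨Complex.imCLM, fun _ => rfl, Complex.abs_im_le_norm⟩
  · exact ⟨-Complex.imCLM, fun _ => rfl, fun z => by simpa using Complex.abs_im_le_norm z⟩

/-- The coefficient of `θ i n` in `L (ℓ (randomSeries p k θ))`. -/
noncomputable def realCoeff (k : ℕ → ℝ) (L : ℂ →L[ℝ] ℝ) (ℓ : StrongDual ℂ (SeqSpace p))
    (q : Fin 2 × ℕ) : ℝ :=
  L (Complex.I ^ (q.1 : ℕ) * ((k q.2 : ℂ) * ℓ (basisVec p q.2)))

theorem abs_realCoeff_le {L : ℂ →L[ℝ] ℝ} (hL : ∀ z, |L z| ≤ ‖z‖)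
    (ℓ : StrongDual ℂ (SeqSpace p)) (q : Fin 2 × ℕ) :
    |realCoeff k L ℓ q| ≤ ‖(k q.2 : ℂ) * ℓ (basisVec p q.2)‖ := by
  refine (hL _).trans_eq ?_
  rw [norm_mul, norm_pow, Complex.norm_I, one_pow, one_mul]

theorem tendsto_sum_realCoeff (L : ℂ →L[ℝ] ℝ) (ℓ : StrongDual ℂ (SeqSpace p)) {ω : Ω}
    (hs : Summable (seriesTerm p k θ ω)) :
    Tendsto (fun N => ∑ q ∈ (Finset.univ : Finset (Fin 2)) ×ˢ Finset.range N,
      realCoeff k L ℓ q * θ q.1 q.2 ω) atTop (𝓝 (L (ℓ (randomSeries p k θ ω)))) := by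
  have h := (L.hasSum (ℓ.hasSum hs.hasSum)).tendsto_sum_nat
  refine h.congr fun N => ?_
  rw [Finset.sum_product_right]
  refine Finset.sum_congr rfl fun n _ => ?_
  rw [Fin.sum_univ_two]
  have h1 : ℓ (seriesTerm p k θ ω n) = θ 0 n ω • ((k n : ℂ) * ℓ (basisVec p n))
      + θ 1 n ω • (Complex.I * ((k n : ℂ) * ℓ (basisVec p n))) := by
    rw [seriesTerm, map_smul]
    simp only [smul_eq_mul, Complex.real_smul]
    ring
  rw [h1, map_add, map_smul, map_smul]
  simp [realCoeff, mul_comm]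

variable [MeasurableSpace Ω] {P : Measure Ω}

/-- By monotone convergence the sum has finite expectation, hence is finite almost surely. -/
theorem ae_summable_of_integral_le {X : ℕ → Ω → ℝ} {c : ℕ → ℝ} (hX0 : ∀ n ω, 0 ≤ X n ω)
    (hX : ∀ n, Integrable (X n) P) (hXc : ∀ n, ∫ ω, X n ω ∂P ≤ c n) (hc : Summable c) :
    ∀ᵐ ω ∂P, Summable fun n => X n ω := by
  have h1 : ∫⁻ ω, ∑' n, ENNReal.ofReal (X n ω) ∂P ≠ ∞ := by
    rw [lintegral_tsum fun n => (hX n).aemeasurable.ennreal_ofReal]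
    have h2 : ∀ n, ∫⁻ ω, ENNReal.ofReal (X n ω) ∂P ≤ ENNReal.ofReal (c n) := fun n => by
      rw [← ofReal_integral_eq_lintegral_ofReal (hX n) (Eventually.of_forall (hX0 n))]
      exact ENNReal.ofReal_le_ofReal (hXc n)
    exact ((ENNReal.tsum_le_tsum h2).trans_lt
      (lt_top_iff_ne_top.2 hc.tsum_ofReal_ne_top)).ne
  filter_upwards [ae_lt_top' (AEMeasurable.tsum fun n =>
    (hX n).aemeasurable.ennreal_ofReal) h1] with ω hω
  have := ENNReal.summable_toReal hω.ne
  simpa only [ENNReal.toReal_ofReal (hX0 _ ω)] using this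

theorem ae_summable_seriesTerm [IsProbabilityMeasure P] (hk0 : ∀ n, 0 ≤ k n) (hk : Summable k) {M : ℝ}
    (hi : ∀ i n, Integrable (fun ω => θ i n ω ^ 2) P) (hM : ∀ i n, ∫ ω, θ i n ω ^ 2 ∂P ≤ M) :
    ∀ᵐ ω ∂P, Summable (seriesTerm p k θ ω) := by
  have hint : ∀ n, Integrable (fun ω => 2 + θ 0 n ω ^ 2 + θ 1 n ω ^ 2) P := fun n =>
    ((integrable_const _).add (hi 0 n)).add (hi 1 n)
  have h := ae_summable_of_integral_le (P := P)
    (X := fun n ω => k n * (2 + θ 0 n ω ^ 2 + θ 1 n ω ^ 2)) (c := fun n => k n * (2 + M + M))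
    (fun n ω => mul_nonneg (hk0 n) (by positivity)) (fun n => (hint n).const_mul _) (fun n => ?_)
    (hk.mul_right _)
  · filter_upwards [h] with ω hω
    exact hω.of_norm_bounded fun n => norm_seriesTerm_le hk0 ω n
  · rw [integral_const_mul]
    refine mul_le_mul_of_nonneg_left ?_ (hk0 n)
    have h1 : Integrable (fun ω => 2 + θ 0 n ω ^ 2) P := (integrable_const _).add (hi 0 n)
    rw [integral_add h1 (hi 1 n), integral_add (integrable_const _) (hi 0 n)]
    have h2 := hM 0 n
    have h3 := hM 1 n
    simp only [integral_const, probReal_univ, smul_eq_mul, one_mul]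
    linarith

theorem aemeasurable_randomSeries [MeasurableSpace (SeqSpace p)] [BorelSpace (SeqSpace p)]
    (hθ : ∀ i n, Measurable (θ i n)) (hs : ∀ᵐ ω ∂P, Summable (seriesTerm p k θ ω)) :
    AEMeasurable (randomSeries p k θ) P := by
  refine AEStronglyMeasurable.aemeasurable ?_
  refine aestronglyMeasurable_of_tendsto_ae atTop
    (f := fun (N : ℕ) ω => ∑ n ∈ Finset.range N, seriesTerm p k θ ω n) (fun N => ?_) ?_
  · refine Finset.aestronglyMeasurable_fun_sum _ fun n _ => ?_
    have h : Measurable fun ω => (k n : ℂ) * ((θ 0 n ω : ℂ) + Complex.I * (θ 1 n ω : ℂ)) := by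
      have := hθ 0 n
      have := hθ 1 n
      fun_prop
    exact h.aestronglyMeasurable.smul_const _
  · filter_upwards [hs] with ω hω
    exact hω.hasSum.tendsto_sum_nat

end Series

/-! ### Mixing maps -/

section Mixing

variable {E : Type*} [NormedAddCommGroup E] [NormedSpace ℂ E] [MeasurableSpace E] [BorelSpace E]
  {T : E →L[ℂ] E} {μ : Measure E} [IsProbabilityMeasure μ]

/-- With `A` the whole space, `μ(T⁻ⁿ B) → μ(B)`. Applied to `T⁻¹ B`, this gives the limit `μ(T⁻¹ B)`
for the same sequence shifted by one, so the two limits agree. -/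
theorem IsStronglyMixing.measurePreserving (h : IsStronglyMixing T μ) :
    MeasurePreserving T μ μ := by
  refine ⟨T.continuous.measurable, Measure.ext fun B hB => ?_⟩
  rw [Measure.map_apply T.continuous.measurable hB]
  have h1 := h Set.univ _ MeasurableSet.univ (T.continuous.measurable hB)
  have h2 := (h Set.univ B MeasurableSet.univ hB).comp (tendsto_add_atTop_nat 1)
  simp only [Set.univ_inter, measure_univ, one_mul] at h1 h2
  refine tendsto_nhds_unique h1 (h2.congr fun n => ?_)
  simp only [Function.comp_apply, pow_succ', mul_apply_eq_comp]
  rfl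

theorem IsStronglyMixing.measurePreserving_pow (h : IsStronglyMixing T μ) (n : ℕ) :
    MeasurePreserving (T ^ n : E →L[ℂ] E) μ μ := by
  induction n with
  | zero => exact MeasurePreserving.id μ
  | succ n ih =>
    rw [pow_succ]
    exact ih.comp h.measurePreserving

theorem correlation_eq_bilinCov (h : IsStronglyMixing T μ) (n : ℕ) (f : E → ℂ) {g : E → ℂ}
    (hg : AEStronglyMeasurable g μ) :
    correlation T μ n f g = bilinCov μ f fun z => g ((T ^ n) z) := by
  have hp := h.measurePreserving_pow n
  have h1 : ∫ z, g ((T ^ n) z) ∂μ = ∫ z, g z ∂μ := by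
    rw [← integral_map hp.aemeasurable (by rwa [hp.map_eq]), hp.map_eq]
  rw [correlation, bilinCov, h1]

end Mixing

/-! ### Exponential series -/

section ExpSeries

variable {E : Type*} [NormedAddCommGroup E] [NormedSpace ℂ E]
  {T : E →L[ℂ] E} {φ : ℂ → ℝ} {a : ℕ → ℂ} {xs : StrongDual ℂ E}

theorem expTerm_eq (z : E) (j : ℕ) :
    expTerm T φ a xs z j = a j * expI (φ (((dualOp T ^ j) xs) z)) := rfl

theorem norm_expTerm (z : E) (j : ℕ) : ‖expTerm T φ a xs z j‖ = ‖a j‖ := by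
  rw [expTerm_eq, norm_mul, norm_expI, mul_one]

theorem expTerm_pow_apply (z : E) (l n : ℕ) :
    expTerm T φ a xs ((T ^ n) z) l = a l * expI (φ (((dualOp T ^ (l + n)) xs) z)) := by
  rw [expTerm_eq, dualOp_pow_apply, dualOp_pow_apply, pow_add, mul_apply_eq_comp]

theorem continuous_expTerm (hφ : Continuous φ) (j : ℕ) :
    Continuous fun z => expTerm T φ a xs z j :=
  continuous_const.mul (continuous_expI.comp (hφ.comp ((dualOp T ^ j) xs).continuous))

theorem continuous_expSeries (hφ : Continuous φ) (ha : Summable fun j => ‖a j‖) :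
    Continuous (expSeries T φ a xs) :=
  continuous_tsum (continuous_expTerm hφ) ha fun j z => (norm_expTerm z j).le

theorem norm_expSeries_le (ha : Summable fun j => ‖a j‖) (z : E) :
    ‖expSeries T φ a xs z‖ ≤ ∑' j, ‖a j‖ :=
  tsum_of_norm_bounded ha.hasSum fun j => (norm_expTerm z j).le

theorem memLp_expSeries [MeasurableSpace E] [BorelSpace E] {μ : Measure E} [IsFiniteMeasure μ]
    (hφ : Continuous φ) (ha : Summable fun j => ‖a j‖) (r : ℝ≥0∞) :
    MemLp (expSeries T φ a xs) r μ :=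
  MemLp.of_bound (continuous_expSeries hφ ha).measurable.aestronglyMeasurable _
    (Eventually.of_forall (norm_expSeries_le ha))

/-- Covariance bounds for the single exponentials add up to a bound for exponential series. -/
theorem norm_bilinCov_expSeries_le [MeasurableSpace E] [BorelSpace E] {μ : Measure E}
    [IsFiniteMeasure μ] {ψ : ℂ → ℝ} (hφ : Continuous φ) (hψ : Continuous ψ) {b : ℕ → ℂ}
    {ys : StrongDual ℂ E} (ha : Summable fun j => ‖a j‖) (hb : Summable fun l => ‖b l‖)
    (n : ℕ) {r s : ℕ → ℝ} (hr : Summable fun j => ‖a j‖ * r j)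
    (hs : Summable fun l => ‖b l‖ * s l)
    (h : ∀ j l, ‖bilinCov μ (fun z => expI (φ (((dualOp T ^ j) xs) z)))
      (fun z => expI (ψ (((dualOp T ^ (l + n)) ys) z)))‖ ≤ r j * s l) :
    ‖bilinCov μ (expSeries T φ a xs) fun z => expSeries T ψ b ys ((T ^ n) z)‖ ≤
      (∑' j, ‖a j‖ * r j) * ∑' l, ‖b l‖ * s l := by
  have hTn : Continuous fun z : E => (T ^ n) z := (T ^ n).continuous
  rw [← tsum_mul_right]
  refine norm_bilinCov_tsum_le (F := fun j z => expTerm T φ a xs z j)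
    (fun j => (continuous_expTerm hφ j).measurable.aestronglyMeasurable)
    ((continuous_expSeries hψ hb).comp hTn).measurable.aestronglyMeasurable
    (fun j z => (norm_expTerm z j).le) (fun z => norm_expSeries_le hb _) ha
    (hr.mul_right _) fun j => ?_
  simp only [expTerm_eq]
  rw [bilinCov_const_mul, norm_mul, mul_assoc]
  refine mul_le_mul_of_nonneg_left ?_ (norm_nonneg _)
  -- The same lemma now expands `g`, against a single exponential of modulus one; hence `C := 1`.
  rw [bilinCov_comm, ← tsum_mul_left]
  refine norm_bilinCov_tsum_le (F := fun l z => expTerm T ψ b ys ((T ^ n) z) l) (C := 1)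
    (fun l => ((continuous_expTerm hψ l).comp hTn).measurable.aestronglyMeasurable)
    (continuous_expI.comp (hφ.comp ((dualOp T ^ j) xs).continuous)).measurable.aestronglyMeasurable
    (fun l z => (norm_expTerm _ l).le) (fun z => (norm_expI _).le) hb (hs.mul_left _) fun l => ?_
  simp only [expTerm_pow_apply]
  rw [bilinCov_const_mul, norm_mul, bilinCov_comm]
  calc _ ≤ ‖b l‖ * (r j * s l) := mul_le_mul_of_nonneg_left (h j l) (norm_nonneg _)
    _ = _ := by ring

end ExpSeries

/-! ### The covariance of two exponentials under the law of the random series -/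

section Decorrelation

variable {Ω : Type*} [MeasurableSpace Ω] {P : Measure Ω}
  {p : ℝ≥0∞} [Fact (1 ≤ p)] {θ : Fin 2 → ℕ → Ω → ℝ}
  [MeasurableSpace (SeqSpace p)] [BorelSpace (SeqSpace p)]

theorem bilinCov_map {F G : SeqSpace p → ℂ} {Z : Ω → SeqSpace p} (hZ : AEMeasurable Z P)
    (hF : Continuous F) (hG : Continuous G) :
    bilinCov (P.map Z) F G = bilinCov P (fun ω => F (Z ω)) (fun ω => G (Z ω)) := by
  unfold bilinCov
  rw [integral_map (f := fun z => F z * G z) hZ (hF.mul hG).measurable.aestronglyMeasurable,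
    integral_map hZ hF.measurable.aestronglyMeasurable,
    integral_map hZ hG.measurable.aestronglyMeasurable]

theorem norm_bilinCov_expI_dualOp_pow_le [IsProbabilityMeasure P] {k₀ : ℝ} {w : ℕ → ℝ} (hk₀ : 0 < k₀)
    (hwp : ∀ n, 0 < w n) (hw : ∃ C, ∀ n, |w n| ≤ C) (hθ : ∀ i n, Measurable (θ i n))
    (hind : iIndepFun (fun q : Fin 2 × ℕ => θ q.1 q.2) P) {M : ℝ}
    (hi : ∀ i n, Integrable (fun ω => θ i n ω ^ 2) P) (hM : ∀ i n, ∫ ω, θ i n ω ^ 2 ∂P ≤ M)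
    (hs : ∀ᵐ ω ∂P, Summable (seriesTerm p (coeff k₀ w) θ ω)) {ρ : ℝ} (hρ : 0 < ρ) (hρ1 : ρ ≤ 1)
    (hk : Summable fun n => coeff k₀ w n ^ (2 * ρ)) {L L' : ℂ →L[ℝ] ℝ}
    (hL : ∀ z, |L z| ≤ ‖z‖) (hL' : ∀ z, |L' z| ≤ ‖z‖) (xs ys : StrongDual ℂ (SeqSpace p))
    (j N : ℕ) :
    ‖bilinCov (P.map (randomSeries p (coeff k₀ w) θ))
      (fun z => expI (L (((dualOp (backwardShift p w hw) ^ j) xs) z)))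
      (fun z => expI (L' (((dualOp (backwardShift p w hw) ^ N) ys) z)))‖ ≤
      16 * (1 + M) ^ 2 * (‖xs‖ ^ ρ * ‖ys‖ ^ ρ) * ‖backwardShift p w hw‖ ^ (j * ρ) *
        ∑' m, coeff k₀ w m ^ ρ * coeff k₀ w (m + N) ^ ρ := by
  set T := backwardShift p w hw
  set k := coeff k₀ w
  have hk0 : ∀ n, 0 ≤ k n := fun n => (coeff_pos hk₀ hwp n).le
  set x := (dualOp T ^ j) xs
  set y := (dualOp T ^ N) ys
  rw [bilinCov_map (F := fun z => expI (L (x z))) (G := fun z => expI (L' (y z)))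
    (aemeasurable_randomSeries hθ hs)
    (continuous_expI.comp (L.continuous.comp x.continuous))
    (continuous_expI.comp (L'.continuous.comp y.continuous))]
  -- The factor `2` counts the two families `θ 0` and `θ 1`, whose coefficients obey the same
  -- bounds; it turns `8` into `16`.
  have hS : ∀ K : ℕ, ∑ q ∈ (Finset.univ : Finset (Fin 2)) ×ˢ Finset.range K,
      |realCoeff k L x q| ^ ρ * |realCoeff k L' y q| ^ ρ ≤
      2 * (‖xs‖ ^ ρ * ‖ys‖ ^ ρ * ‖T‖ ^ (j * ρ) * ∑' m, k m ^ ρ * k (m + N) ^ ρ) := by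
    intro K
    have hq : ∀ q : Fin 2 × ℕ, |realCoeff k L x q| ^ ρ * |realCoeff k L' y q| ^ ρ ≤
        ‖xs‖ ^ ρ * ‖ys‖ ^ ρ * ‖T‖ ^ (j * ρ) *
          (k q.2 ^ ρ * (if q.2 < N then 0 else k (q.2 - N) ^ ρ)) := by
      intro q
      have h1 : |realCoeff k L x q| ^ ρ ≤ ‖xs‖ ^ ρ * ‖T‖ ^ (j * ρ) * k q.2 ^ ρ := by
        rw [Real.rpow_natCast_mul (norm_nonneg _), ← Real.mul_rpow (norm_nonneg _) (by positivity),
          ← Real.mul_rpow (by positivity) (hk0 _)]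
        exact Real.rpow_le_rpow (abs_nonneg _) ((abs_realCoeff_le hL x q).trans
          (norm_coeff_mul_dualOp_pow_le hk₀ hwp T xs j q.2)) hρ.le
      have h2 : |realCoeff k L' y q| ^ ρ ≤
          ‖ys‖ ^ ρ * (if q.2 < N then 0 else k (q.2 - N) ^ ρ) := by
        have h3 := Real.rpow_le_rpow (abs_nonneg _) ((abs_realCoeff_le hL' y q).trans
          (norm_coeff_mul_dualOp_backwardShift_pow_le (hw := hw) hk₀ hwp ys N q.2)) hρ.le
        refine h3.trans_eq ?_
        split_ifs
        · rw [mul_zero, mul_zero, Real.zero_rpow hρ.ne']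
        · rw [Real.mul_rpow (norm_nonneg _) (hk0 _)]
      have h4 := Real.rpow_nonneg (hk0 q.2) ρ
      refine (mul_le_mul h1 h2 (by positivity) (by positivity)).trans_eq (by ring)
    refine (Finset.sum_le_sum fun q _ => hq q).trans ?_
    rw [Finset.sum_product]
    simp only [← Finset.mul_sum, Finset.sum_const, Finset.card_univ, Fintype.card_fin,
      nsmul_eq_mul, Nat.cast_ofNat]
    rw [mul_left_comm]
    exact mul_le_mul_of_nonneg_left (mul_le_mul_of_nonneg_left
      (sum_rpow_mul_ite_le_tsum hk0 hk N K) (by positivity)) zero_le_two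
  refine (norm_bilinCov_expI_le_of_tendsto (ξ := fun q : Fin 2 × ℕ => θ q.1 q.2)
    (fun q => hθ _ _) hind (fun q => hi _ _) (fun q => hM _ _) hρ hρ1
    (hs.mono fun ω h => tendsto_sum_realCoeff L x h)
    (hs.mono fun ω h => tendsto_sum_realCoeff L' y h) hS).trans_eq (by ring)

end Decorrelation

end TemperedShift

theorem corollary6p6
    -- the parameters
    (α : ℝ) (hα : 0 < α ∧ α < 1)
    (p : ℝ≥0∞) [Fact (1 ≤ p)] (hp : p ≤ 2)
    (aNeg aPos lNeg lPos : ℝ) (haNeg : 0 < aNeg) (haPos : 0 < aPos)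
    (hlNeg : 0 < lNeg) (hlPos : 0 < lPos)
    -- the weights, and the coefficients of the random series
    (w : ℕ → ℝ) (hw_pos : ∀ n, 0 < w n) (hw : ∃ C, ∀ n, |w n| ≤ C)
    (k₀ : ℝ) (hk₀ : 0 < k₀) (hk : Summable fun n => coeff k₀ w n ^ α)
    -- independent tempered stable variables
    {Ω : Type*} [MeasurableSpace Ω] (P : Measure Ω) [IsProbabilityMeasure P]
    (θ : Fin 2 → ℕ → Ω → ℝ) (hθ_meas : ∀ i n, Measurable (θ i n))
    (hθ_indep : iIndepFun (fun q : Fin 2 × ℕ => θ q.1 q.2) P)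
    (hθ_law : ∀ i n, IsTemperedStable α aNeg aPos lNeg lPos (P.map (θ i n)))
    -- the Borel structure of `ℓ^p(ℕ)`, the law of the random series, and the shift
    [MeasurableSpace (SeqSpace p)] [BorelSpace (SeqSpace p)]
    (μ : Measure (SeqSpace p)) (hμ : μ = P.map (randomSeries p (coeff k₀ w) θ))
    (T : SeqSpace p →L[ℂ] SeqSpace p) (hT : T = backwardShift p w hw)
    -- the exponential series
    (a b : ℕ → ℂ) (ha : Summable fun j => ‖a j‖) (hb : Summable fun l => ‖b l‖)
    (haT : Summable fun j : ℕ => ‖a j‖ * ‖T‖ ^ ((j : ℝ) * p.toReal / 2))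
    (φ ψ : ℂ → ℝ) (hφ : φ ∈ partFunctions) (hψ : ψ ∈ partFunctions) (hφψ : φ ≠ ψ)
    (xs ys : StrongDual ℂ (SeqSpace p)) :
    -- the law `μ` is well defined: the random series converges almost surely in `ℓ^p(ℕ)`
    ((∀ᵐ ω ∂P, Summable (seriesTerm p (coeff k₀ w) θ ω)) ∧
      AEMeasurable (randomSeries p (coeff k₀ w) θ) P) ∧
    -- `f` and `g` are well defined, and lie in `L²(μ)`
    (∀ z, Summable fun j => ‖expTerm T φ a xs z j‖) ∧
    (∀ z, Summable fun l => ‖expTerm T ψ b ys z l‖) ∧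
    MemLp (expSeries T φ a xs) 2 μ ∧
    MemLp (expSeries T ψ b ys) 2 μ ∧
    -- the rate
    (IsStronglyMixing T μ →
      ∃ C : ℝ, 0 < C ∧ ∀ n : ℕ,
        ‖correlation T μ n (expSeries T φ a xs) (expSeries T ψ b ys)‖ ≤
          C * ∑' l : ℕ, ‖b l‖ *
            ∑' j : ℕ, coeff k₀ w j ^ (p.toReal / 2) * coeff k₀ w (j + l + n) ^ (p.toReal / 2)) := by
  obtain ⟨M, hMθ⟩ := exists_integral_sq_le_of_isTemperedStable hα.2 haNeg haPos hlNeg hlPos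
  have hsq : ∀ i n, Integrable (fun ω => θ i n ω ^ 2) P ∧ ∫ ω, θ i n ω ^ 2 ∂P ≤ M := by
    intro i n
    have := Measure.isProbabilityMeasure_map (μ := P) (hθ_meas i n).aemeasurable
    obtain ⟨h1, h2⟩ := hMθ _ (hθ_law i n)
    rw [integral_map (hθ_meas i n).aemeasurable (by fun_prop)] at h2
    exact ⟨h1.comp_measurable (hθ_meas i n), h2⟩
  have hi := fun i n => (hsq i n).1
  have hM := fun i n => (hsq i n).2
  have hk0 : ∀ n, 0 ≤ coeff k₀ w n := fun n => (coeff_pos hk₀ hw_pos n).le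
  have hp1 : 1 ≤ p.toReal := by
    rw [← ENNReal.toReal_one]
    exact ENNReal.toReal_mono (ne_top_of_le_ne_top (by simp) hp) Fact.out
  have hp2 : p.toReal ≤ 2 := by
    simpa using ENNReal.toReal_mono (by simp) hp
  have hks : Summable (coeff k₀ w) := by
    simpa using summable_rpow_of_le hk0 hα.1 hα.2.le hk
  have hkp : Summable fun n => coeff k₀ w n ^ (2 * (p.toReal / 2)) := by
    rw [mul_div_cancel₀ _ two_ne_zero]
    exact summable_rpow_of_le hk0 hα.1 (hα.2.le.trans hp1) hk
  have hs := ae_summable_seriesTerm (p := p) hk0 hks hi hM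
  have hZ := aemeasurable_randomSeries hθ_meas hs
  have hμP : IsProbabilityMeasure μ := by
    rw [hμ]
    exact Measure.isProbabilityMeasure_map hZ
  obtain ⟨L, hφL, hL⟩ := exists_continuousLinearMap_of_mem_partFunctions hφ
  obtain ⟨L', hψL, hL'⟩ := exists_continuousLinearMap_of_mem_partFunctions hψ
  obtain rfl : φ = L := funext hφL
  obtain rfl : ψ = L' := funext hψL
  refine ⟨⟨hs, hZ⟩, fun z => by simpa only [norm_expTerm] using ha,
    fun z => by simpa only [norm_expTerm] using hb, memLp_expSeries L.continuous ha 2,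
    memLp_expSeries L'.continuous hb 2, fun hmix => ?_⟩
  -- From here on `ρ = p/2`, which lies in `(0, 1]` because `1 ≤ p ≤ 2`.
  set K : ℝ := 16 * (1 + M) ^ 2 * (‖xs‖ ^ (p.toReal / 2) * ‖ys‖ ^ (p.toReal / 2)) with hK
  set S : ℕ → ℝ := fun N =>
    ∑' m, coeff k₀ w m ^ (p.toReal / 2) * coeff k₀ w (m + N) ^ (p.toReal / 2) with hS
  have hS0 : ∀ N, 0 ≤ S N := fun N => tsum_nonneg fun m =>
    mul_nonneg (Real.rpow_nonneg (hk0 _) _) (Real.rpow_nonneg (hk0 _) _)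
  have hK0 : 0 ≤ K := by positivity
  have haT' : Summable fun j : ℕ => ‖a j‖ * (K * ‖T‖ ^ (j * (p.toReal / 2))) := by
    refine (haT.mul_left K).congr fun j => ?_
    rw [mul_div_assoc]
    ring
  have hA0 : 0 ≤ ∑' j : ℕ, ‖a j‖ * (K * ‖T‖ ^ (j * (p.toReal / 2))) :=
    tsum_nonneg fun j => by positivity
  -- The `+ 1` only secures strict positivity, as the sum may vanish.
  refine ⟨(∑' j : ℕ, ‖a j‖ * (K * ‖T‖ ^ (j * (p.toReal / 2)))) + 1, by positivity, fun n => ?_⟩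
  -- The bound on `S` is uniform in the lag, so the series in `l` converges and its `tsum` is not
  -- the default value `0`.
  have hbS : Summable fun l => ‖b l‖ * S (l + n) :=
    Summable.of_nonneg_of_le (fun l => mul_nonneg (norm_nonneg _) (hS0 _))
      (fun l => mul_le_mul_of_nonneg_left
        (tsum_rpow_mul_rpow_add_le hk0 hkp (l + n)) (norm_nonneg _)) (hb.mul_right _)
  rw [correlation_eq_bilinCov hmix n _
    (continuous_expSeries L'.continuous hb).measurable.aestronglyMeasurable]
  have hmain := norm_bilinCov_expSeries_le (μ := μ) (T := T) (xs := xs) (ys := ys) L.continuous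
    L'.continuous ha hb n (r := fun j => K * ‖T‖ ^ (j * (p.toReal / 2)))
    (s := fun l => S (l + n)) haT' hbS fun j l => by
      subst hμ hT
      exact norm_bilinCov_expI_dualOp_pow_le hk₀ hw_pos hw hθ_meas hθ_indep hi hM hs
        (by linarith) (by linarith) hkp hL hL' xs ys j (l + n)
  simp only [add_assoc]
  exact hmain.trans (mul_le_mul_of_nonneg_right (by linarith)
    (tsum_nonneg fun l => mul_nonneg (norm_nonneg _) (hS0 _)))
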